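/- **Setting.** Let $n\ge 1$ and $\mathsf N\ge 0$ be integers, $V=\mathbb C^n$, $\mathcal H=V_1\otimes\cdots\otimes V_{\mathsf N}$ with $V_l=V$, and let $V_a=V$ be an auxiliary space. For $\eta\in\mathbb C$, $\xi_1,\dots,\xi_{\mathsf N}\in\mathbb C$, nonzero $\zeta_\pm\in\mathbb C$ and boundary matrices $\mathcal M^{(\pm)}\in \mathrm{End}(V)$ with $(\mathcal M^{(\pm)})^2=r^{(\pm)}I$, $r^{(\pm)}\in\{0,1\}$, put $R_{aj}(\lambda)=\lambda I+\eta\,\mathbb P_{aj}$ ($\mathbb P_{aj}$ the permutation operator of $V_a$ and $V_j$), $$M_a(\lambda)=R_{a\mathsf N}(\lambda-\xi_{\mathsf N})\cdots R_{a1}(\lambda-\xi_1),\qquad \hat M_a(\lambda)=R_{a1}(\lambda+\xi_1)\cdots R_{a\mathsf N}(\lambda+\xi_{\mathsf N}),$$ $$K_-(\lambda)=I+\frac{\lambda}{\zeta_-}\mathcal M^{(-)},\qquad K_+(\lambda)=I-\frac{\lambda-\sigma n\eta/2}{\zeta_+}\mathcal M^{(+)},$$ $$T(\lambda)=\mathrm{tr}_{V_a}\big[K_{+,a}(\lambda)M_a(\lambda)K_{-,a}(\lambda)\hat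 M_a(\lambda)\big]\in\mathrm{End}(\mathcal H),$$ where $\sigma\in\{1,-1\}$ is a fixed sign; for $\sigma=-1$ the operators $T(\lambda)$ commute with each other. The theorem holds for either sign. For $\langle S|\in\mathcal H^*$ and $(h_1,\dots,h_{\mathsf N})\in\{0,\dots,n-1\}^{\mathsf N}$ let $$\langle h_1,\dots,h_{\mathsf N}|=\langle S|\,T(\xi_1)^{h_1}\cdots T(\xi_{\mathsf N})^{h_{\mathsf N}}.\qquad(*)$$ The separation condition is $\xi_a\ne\xi_b+\epsilon\eta$ for all $a\neq b$ and $\epsilon\in\{-1,0,1\}$. "For almost any choice" of finitely many complex parameters means: for all choices outside the zero set of some nonzero polynomial in these parameters. A boundary matrix in a given conjugacy class is written $\mathcal M^{(\pm)}=W_\pm J_\pm W_\pm^{-1}$ with $J_\pm$ a fixed representative, and "almost any $\mathcal M^{(\pm)}$ in the class" refers to the entries of the invertible matrix $W_\pm$. A conjugacy class of matrices with $\mathcal M^2=I$, respectively $\mathcal M^2=0$, is called generic if it has the largest dimension: the multiplicities of the eigenvalues $1$ and $-1$ differ by at most one, respectively the rank is $\lfloor n/2\rfloor$. A matrix has simple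 spectrum if each of its eigenspaces has dimension one. Finally $$K_a^{(+,-)}=(\alpha_-I+a\,\mathcal M^{(-)})(\alpha_+I+a\,\mathcal M^{(+)}),\qquad \alpha_\pm\in\mathbb C,\ a\in\{1,\dots,\mathsf N\}.$$ **Theorem.** 1. For each choice of generic conjugacy classes for $\mathcal M^{(-)}$ and $\mathcal M^{(+)}$ (with any $r^{(\pm)}\in\{0,1\}$), the co-vectors $(*)$ form a basis of $\mathcal H^*$ for almost any choice of $\langle S|$, of $\eta$, of the inhomogeneities $\xi_a$ subject to the separation condition, and of the boundary parameters $\zeta_\pm\neq0$ and $\mathcal M^{(\pm)}$ in these classes. The same holds for every other pair of conjugacy classes of boundary matrices that contains a pair $(\mathcal M^{(-)},\mathcal M^{(+)})$ for which, with some $\alpha_\pm\in\mathbb C$, all the matrices $K_a^{(+,-)}$, $a=1,\dots,\mathsf N$, have simple spectrum. 2. Let $\mathcal M^{(\pm)}$ be any boundary matrices for which there are $\alpha_\pm\in\mathbb C$ such that $K_a^{(+,-)}$ has simple spectrum for every $a\in\{1,\dots,\mathsf N\}$. Then for each $a$ there is a co-vector $\langle S,a|$ of $V_a$ such that $\langle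 S,a|(K_a^{(+,-)})^h$, $h=0,\dots,n-1$, form a basis of the co-vectors of $V_a$; and for any such co-vectors, with $\langle S|=\bigotimes_{a=1}^{\mathsf N}\langle S,a|$, the co-vectors $(*)$ form a basis of $\mathcal H^*$ for almost any choice of $\eta$, of the $\xi_a$ subject to the separation condition, and of $\zeta_\pm\ne0$. -/

import Mathlib

open scoped Kronecker

noncomputable section

namespace ReflectionSoV

/-! ### The open chain

A site carries `V = ℂⁿ`, with index set `Fin n`. The quantum space `H = V ⊗ ⋯ ⊗ V` (`N` factors)
has the tensor basis indexed by `Fin N → Fin n`; operators on `H` are matrices over this index set,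
operators on `V_a ⊗ H` (with `V_a` the auxiliary space) are matrices over
`Fin n × (Fin N → Fin n)`. Co-vectors of `H` are row vectors, on which operators act from the right
by `Matrix.vecMul`. The site called `a ∈ {1, …, N}` in the text is `a - 1 : Fin N` here. -/

/-- Index set of the tensor basis of the quantum space. -/
abbrev QIdx (n N : ℕ) : Type := Fin N → Fin n

/-- Index set of the tensor basis of `V_a ⊗ H`. -/
abbrev AQIdx (n N : ℕ) : Type := Fin n × (Fin N → Fin n)

/-- The permutation operator `ℙ_{aj}` on `V_a ⊗ H`, exchanging the auxiliary space with site `j`. -/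
def permOp (n N : ℕ) (j : Fin N) : Matrix (AQIdx n N) (AQIdx n N) ℂ :=
  Matrix.of fun x y => if x = (y.2 j, Function.update y.2 j y.1) then 1 else 0

/-- The rational `R`-matrix `R_{aj}(u) = u I + η ℙ_{aj}`. -/
def rOp (n N : ℕ) (η u : ℂ) (j : Fin N) : Matrix (AQIdx n N) (AQIdx n N) ℂ :=
  u • (1 : Matrix (AQIdx n N) (AQIdx n N) ℂ) + η • permOp n N j

/-- Bulk monodromy matrix `M_a(u) = R_{aN}(u - ξ_N) ⋯ R_{a1}(u - ξ_1)`. -/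
def monodromy (n N : ℕ) (η : ℂ) (ξ : Fin N → ℂ) (u : ℂ) : Matrix (AQIdx n N) (AQIdx n N) ℂ :=
  (List.ofFn fun j : Fin N => rOp n N η (u - ξ j) j).reverse.prod

/-- `M̂_a(u) = R_{a1}(u + ξ_1) ⋯ R_{aN}(u + ξ_N)`. -/
def monodromyHat (n N : ℕ) (η : ℂ) (ξ : Fin N → ℂ) (u : ℂ) : Matrix (AQIdx n N) (AQIdx n N) ℂ :=
  (List.ofFn fun j : Fin N => rOp n N η (u + ξ j) j).prod

/-- `K_-(u) = I + (u / ζ_-) 𝓜^(-)`. -/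
def kMinus {n : ℕ} (ζ : ℂ) (M : Matrix (Fin n) (Fin n) ℂ) (u : ℂ) : Matrix (Fin n) (Fin n) ℂ :=
  1 + (u / ζ) • M

/-- `K_+(u) = I - ((u - σ n η / 2) / ζ_+) 𝓜^(+)`, with `σ = 1` or `σ = -1` the sign of the shift;
`σ = -1` is the sign for which the transfer matrices commute with each other. -/
def kPlus {n : ℕ} (σ η ζ : ℂ) (M : Matrix (Fin n) (Fin n) ℂ) (u : ℂ) : Matrix (Fin n) (Fin n) ℂ :=
  1 - ((u - σ * n * η / 2) / ζ) • M

/-- An operator of the auxiliary space, seen on `V_a ⊗ H`. -/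
def onAux (N : ℕ) {n : ℕ} (A : Matrix (Fin n) (Fin n) ℂ) : Matrix (AQIdx n N) (AQIdx n N) ℂ :=
  A ⊗ₖ (1 : Matrix (QIdx n N) (QIdx n N) ℂ)

/-- Partial trace over the auxiliary space. -/
def auxTrace {n N : ℕ} (X : Matrix (AQIdx n N) (AQIdx n N) ℂ) : Matrix (QIdx n N) (QIdx n N) ℂ :=
  Matrix.of fun s t => ∑ i : Fin n, X (i, s) (i, t)

/-- The boundary transfer matrix `T(u) = tr_a [K_{+,a}(u) M_a(u) K_{-,a}(u) M̂_a(u)]`. -/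
def transfer {n N : ℕ} (σ η : ℂ) (ξ : Fin N → ℂ) (ζm ζp : ℂ) (Mm Mp : Matrix (Fin n) (Fin n) ℂ)
    (u : ℂ) : Matrix (QIdx n N) (QIdx n N) ℂ :=
  auxTrace (onAux N (kPlus σ η ζp Mp u) * monodromy n N η ξ u *
    onAux N (kMinus ζm Mm u) * monodromyHat n N η ξ u)

/-- The co-vector `⟨h_1, …, h_N| = ⟨S| T(ξ_1)^{h_1} ⋯ T(ξ_N)^{h_N}`, with `h_a ∈ {0, …, n-1}`. -/
def sovCovector {n N : ℕ} (σ η : ℂ) (ξ : Fin N → ℂ) (ζm ζp : ℂ)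
    (Mm Mp : Matrix (Fin n) (Fin n) ℂ) (S : QIdx n N → ℂ) (h : Fin N → Fin n) : QIdx n N → ℂ :=
  Matrix.vecMul S (List.ofFn fun a : Fin N => transfer σ η ξ ζm ζp Mm Mp (ξ a) ^ (h a : ℕ)).prod

/-- The family `v` is a basis of the space of row vectors indexed by `ι`. -/
def IsBasis {κ ι : Type} (v : κ → ι → ℂ) : Prop :=
  LinearIndependent ℂ v ∧ Submodule.span ℂ (Set.range v) = ⊤

/-- The SoV co-vectors form a basis of `H*`. -/
def IsSoVBasis {n N : ℕ} (σ η : ℂ) (ξ : Fin N → ℂ) (ζm ζp : ℂ)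
    (Mm Mp : Matrix (Fin n) (Fin n) ℂ) (S : QIdx n N → ℂ) : Prop :=
  IsBasis fun h : Fin N → Fin n => sovCovector σ η ξ ζm ζp Mm Mp S h

/-- The separation condition `ξ_a ≠ ξ_b + ε η` for `a ≠ b` and `ε ∈ {-1, 0, 1}`. -/
def Separated {N : ℕ} (η : ℂ) (ξ : Fin N → ℂ) : Prop :=
  ∀ a b : Fin N, a ≠ b → ∀ ε : ℤ, (ε = -1 ∨ ε = 0 ∨ ε = 1) → ξ a ≠ ξ b + ε * η

/-! ### Boundary matrices -/

/-- `𝓜` is a boundary matrix: `𝓜² = r I` with `r = 1` or `r = 0`. -/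
def IsBoundary {n : ℕ} (M : Matrix (Fin n) (Fin n) ℂ) : Prop :=
  M * M = 1 ∨ M * M = 0

/-- The involution `diag(1, …, 1, -1, …, -1)` with `p` entries `1`. The solutions of `𝓜² = I` are
exactly the conjugates of these, `0 ≤ p ≤ n`; the conjugacy class has dimension `2 p (n - p)`. -/
def involForm (n p : ℕ) : Matrix (Fin n) (Fin n) ℂ :=
  Matrix.diagonal fun i => if (i : ℕ) < p then 1 else -1

/-- For `2 k ≤ n`, the square-zero matrix of rank `k` with entries `1` at `(i, i + n - k)`, `i < k`.
The solutions of `𝓜² = 0` are exactly the conjugates of these; the conjugacy class has dimension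
`2 k (n - k)`. -/
def nilForm (n k : ℕ) : Matrix (Fin n) (Fin n) ℂ :=
  Matrix.of fun i j => if (j : ℕ) = (i : ℕ) + (n - k) then 1 else 0

/-- `J` represents a conjugacy class of largest dimension among the solutions of `𝓜² = I`
(multiplicities of `1` and `-1` equal or differing by one) or of `𝓜² = 0` (largest rank). -/
def IsGenericForm {n : ℕ} (J : Matrix (Fin n) (Fin n) ℂ) : Prop :=
  (∃ p : ℕ, n ≤ 2 * p + 1 ∧ 2 * p ≤ n + 1 ∧ J = involForm n p) ∨ J = nilForm n (n / 2)

/-- The matrix `K_a^{(+,-)} = (α_- I + a 𝓜^(-)) (α_+ I + a 𝓜^(+))`, for the site number `a`. -/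
def kProd {n : ℕ} (αm αp : ℂ) (Mm Mp : Matrix (Fin n) (Fin n) ℂ) (a : ℕ) :
    Matrix (Fin n) (Fin n) ℂ :=
  (αm • (1 : Matrix (Fin n) (Fin n) ℂ) + (a : ℂ) • Mm) *
    (αp • (1 : Matrix (Fin n) (Fin n) ℂ) + (a : ℂ) • Mp)

/-- Simple spectrum: no eigenvalue has two linearly independent eigenvectors. (Matrices with
`n` distinct eigenvalues satisfy this; diagonalizability is not required.) -/
def HasSimpleSpectrum {n : ℕ} (A : Matrix (Fin n) (Fin n) ℂ) : Prop :=
  ∀ μ : ℂ, Module.finrank ℂ (Module.End.eigenspace (Matrix.toLin' A) μ) ≤ 1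

/-- The local orbit `⟨s| A^h`, `h = 0, …, n-1`, is a basis of the co-vectors of one site. -/
def IsCyclicCovector {n : ℕ} (s : Fin n → ℂ) (A : Matrix (Fin n) (Fin n) ℂ) : Prop :=
  IsBasis fun h : Fin n => Matrix.vecMul s (A ^ (h : ℕ))

/-- The tensor product co-vector `⨂_a ⟨s_a|`. -/
def tensorCovector {n N : ℕ} (s : Fin N → Fin n → ℂ) : QIdx n N → ℂ :=
  fun i => ∏ a : Fin N, s a (i a)

/-! ### Almost any choice of the parameters -/

/-- `Q` holds for almost any choice of the complex parameters indexed by `σ`: it holds off the zero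
set of a nonzero polynomial in these parameters. -/
def AlmostAny {σ : Type} (Q : (σ → ℂ) → Prop) : Prop :=
  ∃ P : MvPolynomial σ ℂ, P ≠ 0 ∧ ∀ x : σ → ℂ, MvPolynomial.eval x P ≠ 0 → Q x

/-- Names of the parameters `η`, `ξ_a`, `ζ_-`, `ζ_+`. -/
inductive ModelParam (N : ℕ) : Type
  | eta : ModelParam N
  | xi (a : Fin N) : ModelParam N
  | zetaMinus : ModelParam N
  | zetaPlus : ModelParam N

/-- Names of all the parameters: those above, the components of `⟨S|`, and the entries of the two
matrices `W_±` that parametrize `𝓜^(±) = W_± J_± W_±⁻¹` within the conjugacy class of `J_±`. -/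
inductive FullParam (n N : ℕ) : Type
  | model (p : ModelParam N) : FullParam n N
  | covec (s : QIdx n N) : FullParam n N
  | wMinus (i j : Fin n) : FullParam n N
  | wPlus (i j : Fin n) : FullParam n N

/-- The admissible values: the separation condition holds and `ζ_±` are nonzero. -/
def Admissible {N : ℕ} (x : ModelParam N → ℂ) : Prop :=
  Separated (x .eta) (fun a => x (.xi a)) ∧ x .zetaMinus ≠ 0 ∧ x .zetaPlus ≠ 0

/-- The SoV basis property for almost any `η`, inhomogeneities subject to the separation condition
and `ζ_±`, the boundary matrices `𝓜^(±)` and the co-vector `⟨S|` being fixed. -/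
def SoVForAlmostAnyModel {n N : ℕ} (σ : ℂ) (Mm Mp : Matrix (Fin n) (Fin n) ℂ)
    (S : QIdx n N → ℂ) : Prop :=
  AlmostAny fun x : ModelParam N → ℂ => Admissible x →
    IsSoVBasis σ (x .eta) (fun a => x (.xi a)) (x .zetaMinus) (x .zetaPlus) Mm Mp S

/-- The SoV basis property for almost any `⟨S|`, `η`, inhomogeneities subject to the separation
condition, and boundary parameters `ζ_±`, `𝓜^(±)`, with `𝓜^(±)` in the conjugacy class of `J_±`. -/
def SoVForAlmostAny (n N : ℕ) (σ : ℂ) (Jm Jp : Matrix (Fin n) (Fin n) ℂ) : Prop :=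
  AlmostAny fun x : FullParam n N → ℂ =>
    Admissible (fun p => x (.model p)) →
    ∀ Wm Wp : Matrix (Fin n) (Fin n) ℂ,
      Wm = Matrix.of (fun i j => x (.wMinus i j)) → Wp = Matrix.of (fun i j => x (.wPlus i j)) →
      IsUnit Wm → IsUnit Wp →
      IsSoVBasis σ (x (.model .eta)) (fun a => x (.model (.xi a))) (x (.model .zetaMinus))
        (x (.model .zetaPlus)) (Wm * Jm * Wm⁻¹) (Wp * Jp * Wp⁻¹) (fun s => x (.covec s))

end ReflectionSoV

end

/-!
The argument is a specialization at `η = 0`. At `u = ξ_a` the factor `R_{aa}(0) = η ℙ_{aa}` makes the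
monodromy matrix divisible by `η`, so `ζ_- ζ_+ η⁻¹ T(ξ_a)` (`reducedTransfer`) is polynomial in all
the parameters. Replacing `T(ξ_a)` by it multiplies each co-vector by a nonzero scalar
(`isSoVBasis_iff`), so it suffices that one polynomial, the determinant `reducedDet` of the new
co-vectors, is not identically zero. For `η = 0` the other `R`-matrices are scalar, and the new
operator is a nonzero multiple of `(ζ_- I + ξ_a 𝓜^(-)) (ζ_+ I - ξ_a 𝓜^(+))` acting on site `a` alone
(`reducedTransfer_zero`); with `ξ_a = a`, `ζ_- = α_-`, `ζ_+ = -α_+` this is `-K_a^{(+,-)}`. On a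
tensor product `⟨S|` the co-vectors are then tensor products of the local orbits
`⟨S,a| (K_a^{(+,-)})^h`, a basis whenever each local orbit is one (`reducedDet_zero_ne_zero`). The
shift of `K_+` vanishes at `η = 0`. Boundary matrices
`W_± J_± W_±⁻¹` are made polynomial by moving `det W_±` into `ζ_±` (`isSoVBasis_smul_iff`).

A local cyclic co-vector exists because simple spectrum forces the minimal polynomial to have
degree `n` (`le_natDegree_minpoly`, `exists_isCyclicCovector`).

For generic classes a pair with simple spectrum is exhibited. Each class contains an upper bidiagonal
matrix with `2 × 2` blocks at the positions `(0, 1), (2, 3), …` (`exists_isEvenBidiagonal`). Shifting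
the basis cyclically for one of the two matrices staggers the blocks. With `α_± = i` all the factors
are invertible, and `K_a^{(+,-)} v = μ v` becomes
`(1 + r a²) (i + a 𝓜^(+)) v = -μ (i - a 𝓜^(-)) v`, a recursion that determines `v` from its first
component (`hasSimpleSpectrum_kProd_of_staggered`).
-/

noncomputable section

namespace ReflectionSoV

/-! ### Cyclic co-vectors and simple spectrum -/

lemma isBasis_iff_det_ne_zero {ι : Type} [Fintype ι] [DecidableEq ι] (v : ι → ι → ℂ) :
    IsBasis v ↔ (Matrix.of v).det ≠ 0 := by
  have key : LinearIndependent ℂ v ↔ (Matrix.of v).det ≠ 0 := by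
    rw [← isUnit_iff_ne_zero, ← Matrix.isUnit_iff_isUnit_det,
      ← Matrix.linearIndependent_rows_iff_isUnit]
    rfl
  refine ⟨fun h => key.1 h.1, fun h => ⟨key.2 h, ?_⟩⟩
  exact (key.2 h).span_eq_top_of_card_eq_finrank' (by simp)

lemma isBasis_smul_iff {ι : Type} [Fintype ι] [DecidableEq ι] (c : ι → ℂ) (hc : ∀ h, c h ≠ 0)
    (v : ι → ι → ℂ) : IsBasis (fun h => c h • v h) ↔ IsBasis v := by
  have : (Matrix.of fun h => c h • v h).det = (∏ h, c h) * (Matrix.of v).det :=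
    Matrix.det_mul_column c (Matrix.of v)
  rw [isBasis_iff_det_ne_zero, isBasis_iff_det_ne_zero, this, mul_ne_zero_iff]
  simp [Finset.prod_ne_zero_iff, hc]

lemma isCyclicCovector_smul {n : ℕ} {s : Fin n → ℂ} {A : Matrix (Fin n) (Fin n) ℂ} {c : ℂ}
    (hc : c ≠ 0) (h : IsCyclicCovector s A) : IsCyclicCovector s (c • A) := by
  have := (isBasis_smul_iff (fun k : Fin n => c ^ (k : ℕ)) (fun k => pow_ne_zero _ hc)
    (fun k : Fin n => Matrix.vecMul s (A ^ (k : ℕ)))).2 h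
  simpa only [IsCyclicCovector, smul_pow, Matrix.vecMul_smul] using this

lemma finrank_ker_mul_le {V : Type*} [AddCommGroup V] [Module ℂ V] [FiniteDimensional ℂ V]
    (f g : Module.End ℂ V) :
    Module.finrank ℂ (LinearMap.ker (f * g)) ≤
      Module.finrank ℂ (LinearMap.ker f) + Module.finrank ℂ (LinearMap.ker g) := by
  set K := LinearMap.ker (f * g)
  rw [← (g.domRestrict K).finrank_range_add_finrank_ker]
  refine add_le_add (Submodule.finrank_mono ?_) ?_
  · rintro _ ⟨x, rfl⟩
    exact x.2
  · rw [← LinearMap.finrank_range_of_inj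
      (f := K.subtype ∘ₗ (LinearMap.ker (g.domRestrict K)).subtype)
      (by exact (K.injective_subtype.comp (Submodule.injective_subtype _)))]
    refine Submodule.finrank_mono ?_
    rintro _ ⟨x, rfl⟩
    exact x.2

/-- When every eigenspace has dimension at most one, the minimal polynomial has full degree: the
kernel of a product of `d` linear factors in `A` has dimension at most `d`. -/
lemma le_natDegree_minpoly {n : ℕ} {A : Matrix (Fin n) (Fin n) ℂ} (hA : HasSimpleSpectrum A) :
    n ≤ (minpoly ℂ A).natDegree := by
  set f : Module.End ℂ (Fin n → ℂ) := Matrix.toLin' A with hf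
  have hker : ∀ s : Multiset ℂ, Module.finrank ℂ (LinearMap.ker (Polynomial.aeval f
      (s.map fun a => Polynomial.X - Polynomial.C a).prod)) ≤ s.card := by
    intro s
    induction s using Multiset.induction_on with
    | empty => rw [Multiset.map_zero, Multiset.prod_zero, map_one, Module.End.one_eq_id,
        LinearMap.ker_id, finrank_bot]; exact le_rfl
    | cons a s ih =>
      rw [Multiset.map_cons, Multiset.prod_cons, map_mul, Multiset.card_cons, add_comm]
      refine (finrank_ker_mul_le _ _).trans (add_le_add ?_ ih)
      have := hA a
      rw [Module.End.eigenspace_def] at this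
      rwa [map_sub, Polynomial.aeval_X, Polynomial.aeval_C]
  have hint : IsIntegral ℂ A := Algebra.IsIntegral.isIntegral A
  have hsplit := IsAlgClosed.splits (minpoly ℂ A)
  have hprod := hsplit.eq_prod_roots_of_monic (minpoly.monic hint)
  have hz : Polynomial.aeval f (minpoly ℂ A) = 0 := by
    have := Polynomial.aeval_algHom_apply (Matrix.toLinAlgEquiv' : _ ≃ₐ[ℂ] _).toAlgHom A
      (minpoly ℂ A)
    rw [minpoly.aeval, map_zero] at this
    exact this
  have h := hker (minpoly ℂ A).roots
  rw [← hprod, hz, hsplit.natDegree_eq_card_roots.symm] at h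
  rwa [LinearMap.ker_zero, finrank_top, Module.finrank_fin_fun] at h

/-- A matrix with simple spectrum has a cyclic co-vector: any `s` outside the finitely many proper
subspaces `{s | s (m / (X - μ))(A) = 0}`, with `m` the minimal polynomial and `μ` a root of it. -/
lemma exists_isCyclicCovector {n : ℕ} {A : Matrix (Fin n) (Fin n) ℂ} (hA : HasSimpleSpectrum A) :
    ∃ s : Fin n → ℂ, IsCyclicCovector s A := by
  classical
  set m := minpoly ℂ A with hm
  have hint : IsIntegral ℂ A := Algebra.IsIntegral.isIntegral A
  have hm0 : m ≠ 0 := minpoly.ne_zero hint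
  let L : Polynomial ℂ → Submodule ℂ (Fin n → ℂ) := fun p =>
    LinearMap.ker (Matrix.vecMulLinear (Polynomial.aeval A p))
  have hL : ∀ p s, s ∈ L p ↔ Matrix.vecMul s (Polynomial.aeval A p) = 0 := fun p s => Iff.rfl
  let F : Finset (Submodule ℂ (Fin n → ℂ)) :=
    m.roots.toFinset.image fun μ => L (m / (Polynomial.X - Polynomial.C μ))
  have hdiv : ∀ μ ∈ m.roots, (Polynomial.X - Polynomial.C μ) *
      (m / (Polynomial.X - Polynomial.C μ)) = m := fun μ hμ =>
    Polynomial.mul_div_eq_iff_isRoot.2 (Polynomial.isRoot_of_mem_roots hμ)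
  have hF : ⊤ ∉ F := by
    intro h
    obtain ⟨μ, hμ, h⟩ := Finset.mem_image.1 h
    rw [Multiset.mem_toFinset] at hμ
    set q := m / (Polynomial.X - Polynomial.C μ) with hq
    have hq0 : q ≠ 0 := fun h0 => hm0 (by rw [← hdiv μ hμ, ← hq, h0, mul_zero])
    have hAq : Polynomial.aeval A q = 0 := by
      ext i j
      have := (hL q (Pi.single i 1)).1 (h ▸ Submodule.mem_top)
      simpa using congrFun this j
    have h1 := Polynomial.natDegree_le_of_dvd (minpoly.dvd ℂ A hAq) hq0
    have h2 := congrArg Polynomial.natDegree (hdiv μ hμ)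
    rw [Polynomial.natDegree_mul (Polynomial.X_sub_C_ne_zero μ) hq0,
      Polynomial.natDegree_X_sub_C] at h2
    change m.natDegree ≤ _ at h1
    omega
  obtain ⟨s, hs⟩ := (Set.ne_univ_iff_exists_notMem _).1
    (Subspace.biUnion_ne_univ_of_top_notMem hF)
  have hs' : ∀ μ ∈ m.roots, Matrix.vecMul s (Polynomial.aeval A
      (m / (Polynomial.X - Polynomial.C μ))) ≠ 0 := by
    intro μ hμ h0
    exact hs (Set.mem_biUnion (Finset.mem_coe.2 (Finset.mem_image_of_mem _
      (Multiset.mem_toFinset.2 hμ))) ((hL _ s).2 h0))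
  have hann : ∀ p q : Polynomial ℂ, Matrix.vecMul s (Polynomial.aeval A p) = 0 →
      Matrix.vecMul s (Polynomial.aeval A (p * q)) = 0 := by
    intro p q h
    rw [map_mul, ← Matrix.vecMul_vecMul, h, Matrix.zero_vecMul]
  -- The annihilator of `s` is an ideal, so it contains the gcd of any of its elements with `m`.
  have hdvd : ∀ p : Polynomial ℂ, Matrix.vecMul s (Polynomial.aeval A p) = 0 → m ∣ p := by
    intro p hp
    have hg : Matrix.vecMul s (Polynomial.aeval A (EuclideanDomain.gcd p m)) = 0 := by
      rw [EuclideanDomain.gcd_eq_gcd_ab p m, map_add, Matrix.vecMul_add, hann _ _ hp,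
        hann _ _ (by rw [hm, minpoly.aeval, Matrix.vecMul_zero]), add_zero]
    set g := EuclideanDomain.gcd p m with hgdef
    obtain ⟨k, hk⟩ : g ∣ m := EuclideanDomain.gcd_dvd_right p m
    have hk0 : k ≠ 0 := by rintro rfl; exact hm0 (by rw [hk, mul_zero])
    by_cases hku : k.degree = 0
    · have : IsUnit k := Polynomial.isUnit_iff_degree_eq_zero.2 hku
      have : m ∣ g := by
        rw [hk]
        exact (IsUnit.mul_right_dvd this).2 dvd_rfl
      exact this.trans (EuclideanDomain.gcd_dvd_left p m)
    · obtain ⟨μ, hμ⟩ := IsAlgClosed.exists_root k hku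
      have hμm : μ ∈ m.roots := by
        rw [Polynomial.mem_roots hm0, hk]
        exact Polynomial.root_mul_left_of_isRoot _ hμ
      obtain ⟨l, hl⟩ := Polynomial.dvd_iff_isRoot.2 hμ
      refine absurd ?_ (hs' μ hμm)
      have : m / (Polynomial.X - Polynomial.C μ) = g * l := by
        apply mul_left_cancel₀ (Polynomial.X_sub_C_ne_zero μ)
        rw [hdiv μ hμm, hk, hl]
        ring
      rw [this]
      exact hann _ _ hg
  refine ⟨s, ?_⟩
  have hli : LinearIndependent ℂ fun h : Fin n => Matrix.vecMul s (A ^ (h : ℕ)) := by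
    rw [Fintype.linearIndependent_iff]
    intro c hc i
    set p : Polynomial ℂ := ∑ h : Fin n, Polynomial.monomial (h : ℕ) (c h) with hp
    have hps : Matrix.vecMul s (Polynomial.aeval A p) = 0 := by
      rw [hp, map_sum, ← hc]
      change Matrix.vecMulBilin ℂ ℂ s _ = _
      rw [map_sum]
      refine Finset.sum_congr rfl fun h _ => ?_
      rw [Polynomial.aeval_monomial, ← Algebra.smul_def, map_smul]
      rfl
    have hcoeff : p.coeff i = c i := by
      rw [hp, Polynomial.finsetSum_coeff, Finset.sum_eq_single i]
      · simp
      · intro b _ hb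
        rw [Polynomial.coeff_monomial, if_neg (fun h => hb (Fin.ext h))]
      · simp
    have hp0 : p = 0 := by
      by_contra hp0
      have h1 := Polynomial.natDegree_le_of_dvd (hdvd p hps) hp0
      have h2 : p.natDegree ≤ n - 1 := by
        refine Polynomial.natDegree_sum_le_of_forall_le _ _ fun h _ => ?_
        exact (Polynomial.natDegree_monomial_le _).trans (by omega)
      have h3 := le_natDegree_minpoly hA
      have := i.2
      change n ≤ m.natDegree at h3
      omega
    rw [← hcoeff, hp0, Polynomial.coeff_zero]
  exact ⟨hli, hli.span_eq_top_of_card_eq_finrank' (by simp)⟩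

/-! ### Representatives of the generic classes with simple spectrum -/

lemma exists_conj_of_isConj {n : ℕ} {A B : Matrix (Fin n) (Fin n) ℂ} (h : IsConj A B) :
    ∃ W : Matrix (Fin n) (Fin n) ℂ, IsUnit W ∧ W * A * W⁻¹ = B := by
  obtain ⟨c, hc⟩ := h
  refine ⟨c, c.isUnit, ?_⟩
  rw [hc.eq, Matrix.mul_assoc, Matrix.mul_nonsing_inv _
    ((Matrix.isUnit_iff_isUnit_det _).1 c.isUnit), Matrix.mul_one]

lemma isConj_submatrix {n : ℕ} (A : Matrix (Fin n) (Fin n) ℂ) (e : Equiv.Perm (Fin n)) :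
    IsConj A (A.submatrix e e) := by
  have h : e.permMatrix ℂ * (e⁻¹).permMatrix ℂ = 1 := by
    rw [← Matrix.permMatrix_mul, inv_mul_cancel, Matrix.permMatrix_one]
  have h' : (e⁻¹).permMatrix ℂ * e.permMatrix ℂ = 1 := by
    rw [← Matrix.permMatrix_mul, mul_inv_cancel, Matrix.permMatrix_one]
  refine ⟨⟨e.permMatrix ℂ, (e⁻¹).permMatrix ℂ, h, h'⟩, ?_⟩
  ext i j
  simp [Equiv.Perm.permMatrix, PEquiv.toMatrix_toPEquiv_mul, PEquiv.mul_toMatrix_toPEquiv]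

/-- `B` is upper bidiagonal, and its entries next to the diagonal are nonzero exactly in the rows
`0, 2, 4, …`. -/
def IsEvenBidiagonal {n : ℕ} (B : Matrix (Fin n) (Fin n) ℂ) : Prop :=
  (∀ i j : Fin n, (j : ℕ) < i → B i j = 0) ∧ (∀ i j : Fin n, (i : ℕ) + 1 < j → B i j = 0) ∧
    ∀ i j : Fin n, (j : ℕ) = i + 1 → (B i j ≠ 0 ↔ (i : ℕ) % 2 = 0)

/-- The ordering of the basis in which the even positions come before the odd ones. -/
lemma exists_perm_even_first (n : ℕ) : ∃ τ : Equiv.Perm (Fin n), ∀ i : Fin n,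
    (τ i : ℕ) = if (i : ℕ) % 2 = 0 then (i : ℕ) / 2 else (n + 1) / 2 + (i : ℕ) / 2 := by
  let f : Fin n → Fin n := fun i =>
    ⟨if (i : ℕ) % 2 = 0 then (i : ℕ) / 2 else (n + 1) / 2 + (i : ℕ) / 2, by
      have := i.2
      split_ifs <;> omega⟩
  have hf : Function.Injective f := by
    intro i j h
    have h' : (f i : ℕ) = f j := congrArg _ h
    simp only [f] at h'
    have := i.2
    have := j.2
    ext
    split_ifs at h' <;> omega
  exact ⟨Equiv.ofBijective f (Finite.injective_iff_bijective.1 hf), fun i => rfl⟩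

lemma nilForm_mul_nilForm (n : ℕ) : nilForm n (n / 2) * nilForm n (n / 2) = 0 := by
  ext i j
  rw [Matrix.mul_apply, Matrix.zero_apply]
  refine Finset.sum_eq_zero fun k _ => ?_
  simp only [nilForm, Matrix.of_apply]
  have := j.2
  split_ifs <;> first | omega | simp

lemma involForm_mul_nilForm (n : ℕ) :
    involForm n ((n + 1) / 2) * nilForm n (n / 2) = nilForm n (n / 2) := by
  ext i j
  simp only [involForm, nilForm, Matrix.diagonal_mul, Matrix.of_apply]
  have := j.2
  split_ifs <;> first | omega | simp

lemma nilForm_mul_involForm (n : ℕ) :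
    nilForm n (n / 2) * involForm n ((n + 1) / 2) = -nilForm n (n / 2) := by
  ext i j
  simp only [involForm, nilForm, Matrix.mul_diagonal, Matrix.of_apply, Matrix.neg_apply]
  have := j.2
  split_ifs <;> first | omega | simp

lemma involForm_mul_involForm (n p : ℕ) : involForm n p * involForm n p = 1 := by
  rw [involForm, Matrix.diagonal_mul_diagonal, ← Matrix.diagonal_one]
  congr 1
  ext i
  split_ifs <;> norm_num

lemma isConj_involForm_add_nilForm (n : ℕ) :
    IsConj (involForm n ((n + 1) / 2)) (involForm n ((n + 1) / 2) + nilForm n (n / 2)) := by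
  set J := involForm n ((n + 1) / 2)
  set E := nilForm n (n / 2)
  have hE : E * E = 0 := nilForm_mul_nilForm n
  have hJE : J * E = E := involForm_mul_nilForm n
  have hEJ : E * J = -E := nilForm_mul_involForm n
  refine ⟨⟨1 - (1 / 2 : ℂ) • E, 1 + (1 / 2 : ℂ) • E, ?_, ?_⟩, ?_⟩
  · simp [sub_mul, mul_add, hE]
  · simp [add_mul, mul_sub, hE]
  · change (1 - (1 / 2 : ℂ) • E) * J = (J + E) * (1 - (1 / 2 : ℂ) • E)
    simp only [sub_mul, add_mul, mul_sub, one_mul, mul_one, Matrix.smul_mul, Matrix.mul_smul, hE,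
      hJE, hEJ]
    module

lemma isConj_neg {n : ℕ} {A B : Matrix (Fin n) (Fin n) ℂ} (h : IsConj A B) : IsConj (-A) (-B) := by
  obtain ⟨c, hc⟩ := h
  exact ⟨c, hc.neg_right⟩

lemma isConj_involForm_neg {n p : ℕ} (hp : p ≤ n) :
    IsConj (involForm n p) (-involForm n (n - p)) := by
  have h : -involForm n (n - p) = (involForm n p).submatrix Fin.revPerm Fin.revPerm := by
    ext i j
    by_cases hij : i = j
    · subst hij
      have := i.2
      simp only [involForm, Matrix.neg_apply, Matrix.diagonal_apply_eq, Matrix.submatrix_apply,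
        Fin.revPerm_apply, Fin.val_rev]
      split_ifs <;> first | omega | simp
    · have hij' : i.rev ≠ j.rev := fun h => hij (Fin.rev_injective h)
      simp [involForm, Matrix.diagonal_apply_ne _ hij, Matrix.diagonal_apply_ne _ hij']
  rw [h]
  exact isConj_submatrix _ _

/-- Every generic class contains an upper bidiagonal matrix made of `2 × 2` blocks at the positions
`(0, 1), (2, 3), …`. -/
lemma exists_isEvenBidiagonal {n : ℕ} {J : Matrix (Fin n) (Fin n) ℂ} (hJ : IsGenericForm J) :
    ∃ (B : Matrix (Fin n) (Fin n) ℂ) (r : ℕ),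
      IsConj J B ∧ IsEvenBidiagonal B ∧ B * B = (r : ℂ) • 1 := by
  obtain ⟨τ, hτ⟩ := exists_perm_even_first n
  have hnil : ∀ i j, (nilForm n (n / 2)).submatrix τ τ i j =
      if (i : ℕ) % 2 = 0 ∧ (j : ℕ) = i + 1 then 1 else 0 := by
    intro i j
    simp only [Matrix.submatrix_apply, nilForm, Matrix.of_apply, hτ]
    have := i.2
    have := j.2
    congr 1
    apply propext
    split_ifs <;> omega
  have hsq : ∀ A : Matrix (Fin n) (Fin n) ℂ,
      A.submatrix τ τ * A.submatrix τ τ = (A * A).submatrix τ τ := fun A =>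
    Matrix.submatrix_mul_equiv A A τ τ τ
  have hNE : IsEvenBidiagonal ((nilForm n (n / 2)).submatrix τ τ) := by
    refine ⟨fun i j h => ?_, fun i j h => ?_, fun i j h => ?_⟩
    · rw [hnil, if_neg (by omega)]
    · rw [hnil, if_neg (by omega)]
    · rw [hnil]
      simp [h]
  set M := involForm n ((n + 1) / 2) + nilForm n (n / 2) with hM
  have hoff : ∀ i j : Fin n, i ≠ j → M.submatrix τ τ i j =
      (nilForm n (n / 2)).submatrix τ τ i j := by
    intro i j h
    simp [hM, involForm, Matrix.diagonal_apply_ne _ (fun h' => h (τ.injective h'))]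
  have hME : IsEvenBidiagonal (M.submatrix τ τ) := by
    refine ⟨fun i j h => ?_, fun i j h => ?_, fun i j h => ?_⟩
    · rw [hoff i j (by rintro rfl; omega), hNE.1 i j h]
    · rw [hoff i j (by rintro rfl; omega), hNE.2.1 i j h]
    · rw [hoff i j (by rintro rfl; omega), hNE.2.2 i j h]
  have hMM : M * M = 1 := by
    rw [hM, add_mul, mul_add, mul_add, involForm_mul_involForm, involForm_mul_nilForm,
      nilForm_mul_involForm, nilForm_mul_nilForm]
    abel
  have hMτ : M.submatrix τ τ * M.submatrix τ τ = 1 := by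
    rw [hsq, hMM]
    simp
  rcases hJ with ⟨p, h1, h2, rfl⟩ | rfl
  · by_cases hp : p = (n + 1) / 2
    · subst hp
      exact ⟨M.submatrix τ τ, 1, (isConj_involForm_add_nilForm n).trans (isConj_submatrix _ τ),
        hME, by simpa using hMτ⟩
    · -- For odd `n` the other class is minus the first one.
      have hp' : n - p = (n + 1) / 2 := by omega
      have hc := isConj_involForm_neg (n := n) (p := p) (by omega)
      rw [hp'] at hc
      refine ⟨-M.submatrix τ τ, 1, hc.trans (isConj_neg
        ((isConj_involForm_add_nilForm n).trans (isConj_submatrix _ τ))), ?_, by simpa using hMτ⟩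
      refine ⟨fun i j h => ?_, fun i j h => ?_, fun i j h => ?_⟩
      · rw [Matrix.neg_apply, hME.1 i j h, neg_zero]
      · rw [Matrix.neg_apply, hME.2.1 i j h, neg_zero]
      · rw [Matrix.neg_apply, neg_ne_zero, hME.2.2 i j h]
  · refine ⟨(nilForm n (n / 2)).submatrix τ τ, 0, isConj_submatrix _ τ, hNE, ?_⟩
    rw [hsq, nilForm_mul_nilForm]
    simp

lemma I_add_mul_I_sub {n : ℕ} {M : Matrix (Fin n) (Fin n) ℂ} {r : ℕ} (hM : M * M = (r : ℂ) • 1)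
    (a : ℕ) : (Complex.I • (1 : Matrix (Fin n) (Fin n) ℂ) - (a : ℂ) • M) *
      (Complex.I • (1 : Matrix (Fin n) (Fin n) ℂ) + (a : ℂ) • M) =
        (-(1 + (a : ℂ) ^ 2 * r)) • 1 := by
  simp only [sub_mul, mul_add, Matrix.smul_mul, Matrix.mul_smul, hM, one_mul, mul_one, smul_smul,
    Complex.I_mul_I]
  module

lemma neg_one_add_sq_mul_ne_zero (a r : ℕ) : -(1 + (a : ℂ) ^ 2 * r) ≠ 0 := by
  rw [neg_ne_zero]
  have h : (1 + a ^ 2 * r : ℕ) ≠ 0 := by positivity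
  exact_mod_cast h

/-- Two block matrices whose blocks are staggered, one against the other, give a product with simple
spectrum. Multiplying the eigenvalue equation by `i - a 𝓜^(-)` makes it linear in each of `𝓜^(±)`;
its rows but the last then determine an eigenvector from its first component. -/
lemma hasSimpleSpectrum_kProd_of_staggered {n : ℕ} (hn : 1 ≤ n) {Mm Mp : Matrix (Fin n) (Fin n) ℂ}
    {r r' : ℕ} (hm2 : Mm * Mm = (r : ℂ) • 1) (hp2 : Mp * Mp = (r' : ℂ) • 1)
    (hm0 : ∀ i j : Fin n, (i : ℕ) + 1 < j → Mm i j = 0)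
    (hp0 : ∀ i j : Fin n, (i : ℕ) + 1 < j → Mp i j = 0)
    (hm1 : ∀ i j : Fin n, (j : ℕ) = i + 1 → (Mm i j ≠ 0 ↔ (i : ℕ) % 2 = 0))
    (hp1 : ∀ i j : Fin n, (j : ℕ) = i + 1 → (Mp i j ≠ 0 ↔ (i : ℕ) % 2 = 1))
    {a : ℕ} (ha : a ≠ 0) : HasSimpleSpectrum (kProd Complex.I Complex.I Mm Mp a) := by
  intro μ
  have ha' : (a : ℂ) ≠ 0 := by exact_mod_cast ha
  have hinj : ∀ v ∈ Module.End.eigenspace (Matrix.toLin' (kProd Complex.I Complex.I Mm Mp a)) μ,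
      v ⟨0, hn⟩ = 0 → v = 0 := by
    intro v hv hv0
    rw [Module.End.mem_eigenspace_iff, Matrix.toLin'_apply] at hv
    set c : ℂ := -(1 + (a : ℂ) ^ 2 * r) with hc
    have hc0 : c ≠ 0 := neg_one_add_sq_mul_ne_zero a r
    have heq : c • (Complex.I • v + (a : ℂ) • Mp.mulVec v) =
        μ • (Complex.I • v - (a : ℂ) • Mm.mulVec v) := by
      have h := congrArg (Matrix.mulVec
        (Complex.I • (1 : Matrix (Fin n) (Fin n) ℂ) - (a : ℂ) • Mm)) hv
      rw [kProd, Matrix.mulVec_mulVec, ← Matrix.mul_assoc, I_add_mul_I_sub hm2,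
        Matrix.mulVec_smul] at h
      simpa only [Matrix.smul_mul, Matrix.smul_mulVec, one_mul, Matrix.add_mulVec,
        Matrix.sub_mulVec, Matrix.one_mulVec] using h
    by_cases hμ : μ = 0
    · rw [hμ, zero_smul, smul_eq_zero_iff_right hc0] at heq
      have h := congrArg (Matrix.mulVec
        (Complex.I • (1 : Matrix (Fin n) (Fin n) ℂ) - (a : ℂ) • Mp)) heq
      have h' : Complex.I • v + (a : ℂ) • Mp.mulVec v =
          (Complex.I • (1 : Matrix (Fin n) (Fin n) ℂ) + (a : ℂ) • Mp).mulVec v := by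
        simp only [Matrix.smul_mulVec, Matrix.add_mulVec, Matrix.one_mulVec]
      rw [h', Matrix.mulVec_mulVec, I_add_mul_I_sub hp2, Matrix.smul_mulVec, Matrix.one_mulVec,
        Matrix.mulVec_zero, smul_eq_zero_iff_right (neg_one_add_sq_mul_ne_zero a r')] at h
      exact h
    · have key : ∀ k : ℕ, ∀ hk : k < n, v ⟨k, hk⟩ = 0 := by
        intro k
        induction k using Nat.strong_induction_on with
        | _ k ih =>
        intro hk
        rcases k with _ | k
        · exact hv0
        · have hrow : ∀ M : Matrix (Fin n) (Fin n) ℂ,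
              (∀ i j : Fin n, (i : ℕ) + 1 < j → M i j = 0) →
              M.mulVec v ⟨k, by omega⟩ = M ⟨k, by omega⟩ ⟨k + 1, hk⟩ * v ⟨k + 1, hk⟩ := by
            intro M hM
            rw [Matrix.mulVec, dotProduct]
            refine Finset.sum_eq_single _ (fun j _ hj => ?_) (by simp)
            have hj' : (j : ℕ) ≠ k + 1 := fun h => hj (Fin.ext h)
            rcases lt_or_gt_of_ne hj' with h | h
            · rw [ih j h j.2, mul_zero]
            · rw [hM _ _ h, zero_mul]
          have h := congrFun heq ⟨k, by omega⟩
          simp only [Pi.smul_apply, Pi.add_apply, Pi.sub_apply, smul_eq_mul, hrow Mm hm0,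
            hrow Mp hp0, ih k (Nat.lt_succ_self k) (by omega), mul_zero, zero_add, zero_sub] at h
          have h1 := hm1 ⟨k, by omega⟩ ⟨k + 1, hk⟩ rfl
          have h2 := hp1 ⟨k, by omega⟩ ⟨k + 1, hk⟩ rfl
          rcases Nat.mod_two_eq_zero_or_one k with hk2 | hk2
          · have e1 := h1.2 hk2
            have e2 : Mp ⟨k, by omega⟩ ⟨k + 1, hk⟩ = 0 := by
              by_contra h0
              have := h2.1 h0
              simp only at this
              omega
            rw [e2] at h
            simpa [hμ, ha', e1] using h
          · have e1 := h2.2 hk2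
            have e2 : Mm ⟨k, by omega⟩ ⟨k + 1, hk⟩ = 0 := by
              by_contra h0
              have := h1.1 h0
              simp only at this
              omega
            rw [e2] at h
            simpa [hc0, ha', e1] using h
      ext i
      exact key i i.2
  let φ : Module.End.eigenspace (Matrix.toLin' (kProd Complex.I Complex.I Mm Mp a)) μ →ₗ[ℂ] ℂ :=
    (LinearMap.proj ⟨0, hn⟩ : (Fin n → ℂ) →ₗ[ℂ] ℂ) ∘ₗ Submodule.subtype _
  have hφ : Function.Injective φ := by
    rw [← LinearMap.ker_eq_bot, LinearMap.ker_eq_bot']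
    intro v hv
    exact Subtype.ext (hinj v v.2 hv)
  simpa using LinearMap.finrank_le_finrank_of_injective hφ

/-- Cyclic shift of the basis by one position staggers the blocks of one matrix against those of the
other. -/
lemma exists_hasSimpleSpectrum_of_isGenericForm {n : ℕ} (hn : 1 ≤ n)
    {Jm Jp : Matrix (Fin n) (Fin n) ℂ} (hm : IsGenericForm Jm) (hp : IsGenericForm Jp) :
    ∃ Wm Wp : Matrix (Fin n) (Fin n) ℂ, IsUnit Wm ∧ IsUnit Wp ∧ ∀ a : ℕ, a ≠ 0 →
      HasSimpleSpectrum
        (kProd Complex.I Complex.I (Wm * Jm * Wm⁻¹) (Wp * Jp * Wp⁻¹) a) := by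
  obtain ⟨Bm, r, hmc, hmB, hm2⟩ := exists_isEvenBidiagonal hm
  obtain ⟨Bp, r', hpc, hpB, hp2⟩ := exists_isEvenBidiagonal hp
  obtain ⟨ρ, hρ0, hρ1⟩ : ∃ ρ : Equiv.Perm (Fin n), (∀ i : Fin n, (i : ℕ) = 0 → (ρ i : ℕ) = n - 1) ∧
      ∀ i : Fin n, (i : ℕ) ≠ 0 → (ρ i : ℕ) = i - 1 := by
    let f : Fin n → Fin n := fun i => ⟨if (i : ℕ) = 0 then n - 1 else i - 1, by
      have := i.2
      split_ifs <;> omega⟩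
    have hf : Function.Injective f := by
      intro i j h
      have h' : (f i : ℕ) = f j := congrArg _ h
      simp only [f] at h'
      have := i.2
      have := j.2
      ext
      split_ifs at h' <;> omega
    exact ⟨Equiv.ofBijective f (Finite.injective_iff_bijective.1 hf),
      fun i hi => if_pos hi, fun i hi => if_neg hi⟩
  obtain ⟨Wm, hWm, hWm'⟩ := exists_conj_of_isConj hmc
  obtain ⟨Wp, hWp, hWp'⟩ := exists_conj_of_isConj (hpc.trans (isConj_submatrix Bp ρ))
  refine ⟨Wm, Wp, hWm, hWp, fun a ha => ?_⟩
  rw [hWm', hWp']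
  refine hasSimpleSpectrum_kProd_of_staggered hn hm2 (r' := r') ?_ hmB.2.1 ?_ hmB.2.2 ?_ ha
  · rw [Matrix.submatrix_mul_equiv, hp2, Matrix.submatrix_smul, Pi.smul_apply, Pi.smul_apply,
      Matrix.submatrix_one_equiv]
  · intro i j hij
    have hj := hρ1 j (by omega)
    have := j.2
    rw [Matrix.submatrix_apply]
    rcases Nat.eq_zero_or_pos (i : ℕ) with hi | hi
    · exact hpB.1 _ _ (by rw [hj, hρ0 i hi]; omega)
    · exact hpB.2.1 _ _ (by rw [hj, hρ1 i (by omega)]; omega)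
  · intro i j hij
    have hj := hρ1 j (by omega)
    have := j.2
    rw [Matrix.submatrix_apply]
    rcases Nat.eq_zero_or_pos (i : ℕ) with hi | hi
    · rw [hpB.1 _ _ (by rw [hj, hρ0 i hi]; omega)]
      simp [hi]
    · have hi' := hρ1 i (by omega)
      rw [hpB.2.2 _ _ (by omega)]
      omega

/-! ### The transfer matrix at the inhomogeneities -/

/-- The operator of the quantum space acting as `A` on site `a`. -/
def siteOp {n N : ℕ} (a : Fin N) (A : Matrix (Fin n) (Fin n) ℂ) :
    Matrix (QIdx n N) (QIdx n N) ℂ :=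
  Matrix.of fun s t => if s = Function.update t a (s a) then A (s a) (t a) else 0

/-- The factor of the monodromy matrix at `u = ξ_a` and site `j`, up to a factor `η` at `j = a`,
where `R_{aj}(0) = η ℙ_{aj}`. -/
def reducedFactor (n : ℕ) {N : ℕ} (η : ℂ) (ξ : Fin N → ℂ) (a j : Fin N) :
    Matrix (AQIdx n N) (AQIdx n N) ℂ :=
  if j = a then permOp n N j else rOp n N η (ξ a - ξ j) j

/-- The operator `ζ_- ζ_+ η⁻¹ T(ξ_a)`, written without denominators so as to be polynomial in all
the parameters. -/
def reducedTransfer {n N : ℕ} (σ η : ℂ) (ξ : Fin N → ℂ) (ζm ζp : ℂ)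
    (Mm Mp : Matrix (Fin n) (Fin n) ℂ) (a : Fin N) : Matrix (QIdx n N) (QIdx n N) ℂ :=
  auxTrace (onAux N (ζp • 1 - (ξ a - σ * n * η / 2) • Mp) *
    ((List.finRange N).reverse.map (reducedFactor n η ξ a)).prod *
    onAux N (ζm • 1 + ξ a • Mm) * monodromyHat n N η ξ (ξ a))

/-- The determinant of the co-vectors built from `ζ_- ζ_+ η⁻¹ T(ξ_a)` in place of `T(ξ_a)`. -/
def reducedDet {n N : ℕ} (σ η : ℂ) (ξ : Fin N → ℂ) (ζm ζp : ℂ)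
    (Mm Mp : Matrix (Fin n) (Fin n) ℂ) (S : QIdx n N → ℂ) : ℂ :=
  (Matrix.of fun h : Fin N → Fin n => Matrix.vecMul S
    (List.ofFn fun a : Fin N => reducedTransfer σ η ξ ζm ζp Mm Mp a ^ (h a : ℕ)).prod).det

lemma list_prod_map_smul {ι A : Type*} [Semiring A] [Algebra ℂ A] (l : List ι) (c : ι → ℂ)
    (F : ι → A) : (l.map fun j => c j • F j).prod = (l.map c).prod • (l.map F).prod := by
  induction l with
  | nil => simp
  | cons i l ih => simp [ih, smul_smul, mul_comm]

lemma auxTrace_smul {n N : ℕ} (c : ℂ) (X : Matrix (AQIdx n N) (AQIdx n N) ℂ) :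
    auxTrace (c • X) = c • auxTrace X := by
  ext s t
  simp [auxTrace, Finset.mul_sum]

lemma onAux_smul {n N : ℕ} (c : ℂ) (A : Matrix (Fin n) (Fin n) ℂ) :
    onAux N (c • A) = c • onAux N A := by
  simp [onAux, Matrix.smul_kronecker]

lemma monodromy_eq_smul {n N : ℕ} (η : ℂ) (ξ : Fin N → ℂ) (a : Fin N) :
    monodromy n N η ξ (ξ a) =
      η • ((List.finRange N).reverse.map (reducedFactor n η ξ a)).prod := by
  have h : (fun j : Fin N => rOp n N η (ξ a - ξ j) j) =
      fun j => (if j = a then η else 1) • reducedFactor n η ξ a j := by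
    funext j
    by_cases hj : j = a
    · subst hj
      simp [reducedFactor, rOp]
    · simp [reducedFactor, hj]
  rw [monodromy, List.ofFn_eq_map, ← List.map_reverse, h, list_prod_map_smul, List.map_reverse,
    List.prod_reverse, ← List.ofFn_eq_map, List.prod_ofFn]
  simp

lemma transfer_eq_smul_reducedTransfer {n N : ℕ} (σ η : ℂ) (ξ : Fin N → ℂ) {ζm ζp : ℂ}
    (hm : ζm ≠ 0) (hp : ζp ≠ 0) (Mm Mp : Matrix (Fin n) (Fin n) ℂ) (a : Fin N) :
    transfer σ η ξ ζm ζp Mm Mp (ξ a) =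
      (η / (ζm * ζp)) • reducedTransfer σ η ξ ζm ζp Mm Mp a := by
  have h1 : kPlus σ η ζp Mp (ξ a) = ζp⁻¹ • (ζp • 1 - (ξ a - σ * n * η / 2) • Mp) := by
    rw [kPlus, smul_sub, smul_smul, smul_smul, inv_mul_cancel₀ hp, one_smul, div_eq_inv_mul]
  have h2 : kMinus ζm Mm (ξ a) = ζm⁻¹ • (ζm • 1 + ξ a • Mm) := by
    rw [kMinus, smul_add, smul_smul, smul_smul, inv_mul_cancel₀ hm, one_smul, div_eq_inv_mul]
  rw [transfer, h1, h2, monodromy_eq_smul, onAux_smul, onAux_smul, reducedTransfer]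
  simp only [Matrix.smul_mul, Matrix.mul_smul, smul_smul, ← auxTrace_smul]
  congr 2
  field_simp

lemma isSoVBasis_iff {n N : ℕ} (σ : ℂ) {η : ℂ} (ξ : Fin N → ℂ) {ζm ζp : ℂ} (hη : η ≠ 0)
    (hm : ζm ≠ 0) (hp : ζp ≠ 0) (Mm Mp : Matrix (Fin n) (Fin n) ℂ) (S : QIdx n N → ℂ) :
    IsSoVBasis σ η ξ ζm ζp Mm Mp S ↔ reducedDet σ η ξ ζm ζp Mm Mp S ≠ 0 := by
  have hc : η / (ζm * ζp) ≠ 0 := div_ne_zero hη (mul_ne_zero hm hp)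
  rw [reducedDet, ← isBasis_iff_det_ne_zero, IsSoVBasis]
  refine Iff.trans ?_ (isBasis_smul_iff
    (fun h : Fin N → Fin n => ((List.finRange N).map fun a => (η / (ζm * ζp)) ^ (h a : ℕ)).prod)
    (fun h => ?_) _)
  · congr! 2 with h
    rw [sovCovector, List.ofFn_eq_map, List.ofFn_eq_map, ← Matrix.vecMul_smul, ← list_prod_map_smul]
    simp only [transfer_eq_smul_reducedTransfer σ η ξ hm hp, smul_pow]
  · rw [← List.ofFn_eq_map, List.prod_ofFn]
    exact Finset.prod_ne_zero_iff.2 fun a _ => pow_ne_zero _ hc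

lemma kMinus_smul {n : ℕ} {d : ℂ} (hd : d ≠ 0) (ζ : ℂ) (M : Matrix (Fin n) (Fin n) ℂ) (u : ℂ) :
    kMinus (d * ζ) (d • M) u = kMinus ζ M u := by
  rw [kMinus, kMinus, smul_smul, div_mul_eq_mul_div, mul_comm u d, mul_div_mul_left _ _ hd]

lemma kPlus_smul {n : ℕ} {d : ℂ} (hd : d ≠ 0) (σ η ζ : ℂ) (M : Matrix (Fin n) (Fin n) ℂ) (u : ℂ) :
    kPlus σ η (d * ζ) (d • M) u = kPlus σ η ζ M u := by
  rw [kPlus, kPlus, smul_smul, div_mul_eq_mul_div, mul_comm _ d, mul_div_mul_left _ _ hd]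

/-- Only the ratios `𝓜^(±) / ζ_±` matter. -/
lemma isSoVBasis_smul_iff {n N : ℕ} (σ η : ℂ) (ξ : Fin N → ℂ) (ζm ζp : ℂ) {d e : ℂ} (hd : d ≠ 0)
    (he : e ≠ 0) (Mm Mp : Matrix (Fin n) (Fin n) ℂ) (S : QIdx n N → ℂ) :
    IsSoVBasis σ η ξ (d * ζm) (e * ζp) (d • Mm) (e • Mp) S ↔ IsSoVBasis σ η ξ ζm ζp Mm Mp S := by
  unfold IsSoVBasis sovCovector transfer
  simp only [kMinus_smul hd, kPlus_smul he]

/-! ### The point `η = 0` -/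

lemma list_prod_finRange_single {M : Type*} [Monoid M] {N : ℕ} (a : Fin N) (f : Fin N → M)
    (hf : ∀ j, j ≠ a → f j = 1) (l : List (Fin N)) (hl : l.Perm (List.finRange N)) :
    (l.map f).prod = f a := by
  rw [List.prod_map_eq_pow_single a f fun j hj _ => hf j hj, hl.count_eq,
    List.count_eq_one_of_mem (List.nodup_finRange N) (List.mem_finRange a), pow_one]

lemma rOp_zero {n N : ℕ} (u : ℂ) (j : Fin N) :
    rOp n N 0 u j = u • (1 : Matrix (AQIdx n N) (AQIdx n N) ℂ) := by
  simp [rOp]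

lemma auxTrace_onAux_mul_permOp {n N : ℕ} (A B : Matrix (Fin n) (Fin n) ℂ) (a : Fin N) :
    auxTrace (onAux N A * permOp n N a * onAux N B) = siteOp a (B * A) := by
  ext s t
  have h1 : ∀ (i m : Fin n) (u : QIdx n N), (onAux N A * permOp n N a) (i, s) (m, u) =
      if s = Function.update u a m then A i (u a) else 0 := by
    intro i m u
    rw [Matrix.mul_apply, Finset.sum_eq_single (u a, s)]
    · simp [onAux, permOp]
    · rintro ⟨k, w⟩ _ hkw
      by_cases hw : s = w
      · subst hw
        have : k ≠ u a := fun h => hkw (by rw [h])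
        simp [permOp, this]
      · simp [onAux, hw]
    · simp
  have h2 : ∀ i, (onAux N A * permOp n N a * onAux N B) (i, s) (i, t) =
      if s = Function.update t a (s a) then A i (t a) * B (s a) i else 0 := by
    intro i
    rw [Matrix.mul_apply, Finset.sum_eq_single (s a, t)]
    · rw [h1]
      simp [onAux]
    · rintro ⟨m, u⟩ _ hmu
      rw [h1]
      by_cases hu : u = t
      · subst hu
        rw [if_neg, zero_mul]
        intro hs
        apply hmu
        rw [hs]
        simp
      · simp [onAux, hu]
    · simp
  simp only [auxTrace, Matrix.of_apply, h2, siteOp]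
  split_ifs
  · rw [Matrix.mul_apply]
    exact Finset.sum_congr rfl fun i _ => mul_comm _ _
  · simp

/-- At `η = 0` the operators `ζ_- ζ_+ η⁻¹ T(ξ_a)` act on single sites. -/
lemma reducedTransfer_zero {n N : ℕ} (σ : ℂ) (ξ : Fin N → ℂ) (ζm ζp : ℂ)
    (Mm Mp : Matrix (Fin n) (Fin n) ℂ) (a : Fin N) :
    reducedTransfer σ 0 ξ ζm ζp Mm Mp a =
      ((∏ j, if j = a then 1 else ξ a - ξ j) * ∏ j, (ξ a + ξ j)) •
        siteOp a ((ζm • 1 + ξ a • Mm) * (ζp • 1 - ξ a • Mp)) := by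
  have h1 : ((List.finRange N).reverse.map (reducedFactor n 0 ξ a)).prod =
      (∏ j, if j = a then 1 else ξ a - ξ j) • permOp n N a := by
    have h : reducedFactor n 0 ξ a = fun j => (if j = a then (1 : ℂ) else ξ a - ξ j) •
        if j = a then permOp n N a else 1 := by
      funext j
      by_cases hj : j = a
      · subst hj
        simp [reducedFactor]
      · simp [reducedFactor, hj, rOp_zero]
    rw [h, list_prod_map_smul, list_prod_finRange_single a _ (fun j hj => if_neg hj) _
      (List.reverse_perm _), if_pos rfl, List.map_reverse, List.prod_reverse, ← List.ofFn_eq_map,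
      List.prod_ofFn]
  have h2 : monodromyHat n N 0 ξ (ξ a) = (∏ j, (ξ a + ξ j)) • 1 := by
    rw [monodromyHat]
    simp only [rOp_zero]
    rw [List.ofFn_eq_map, list_prod_map_smul, ← List.ofFn_eq_map, List.prod_ofFn]
    simp
  rw [reducedTransfer, h1, h2, ← auxTrace_onAux_mul_permOp]
  simp only [Matrix.smul_mul, Matrix.mul_smul, mul_one, smul_smul, auxTrace_smul, mul_zero,
    zero_div, sub_zero]
  rw [mul_comm]

lemma tensorCovector_vecMul_siteOp {n N : ℕ} (s : Fin N → Fin n → ℂ) (a : Fin N)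
    (A : Matrix (Fin n) (Fin n) ℂ) :
    Matrix.vecMul (tensorCovector s) (siteOp a A) =
      tensorCovector (Function.update s a (Matrix.vecMul (s a) A)) := by
  ext t
  have hrhs : tensorCovector (Function.update s a (Matrix.vecMul (s a) A)) t =
      Matrix.vecMul (s a) A (t a) * ∏ b ∈ Finset.univ.erase a, s b (t b) := by
    rw [tensorCovector, ← Finset.mul_prod_erase _ _ (Finset.mem_univ a), Function.update_self]
    congr 1
    refine Finset.prod_congr rfl fun b hb => ?_
    rw [Function.update_of_ne (Finset.ne_of_mem_erase hb)]
  rw [hrhs, Matrix.vecMul, dotProduct, Matrix.vecMul, dotProduct, Finset.sum_mul]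
  symm
  refine Finset.sum_of_injOn (fun k => Function.update t a k) ?_ (by simp) ?_ ?_
  · intro k _ k' _ h
    simpa using congrFun h a
  · intro u _ hu
    rw [siteOp, Matrix.of_apply, if_neg, mul_zero]
    intro h
    exact hu ⟨u a, by simp, h.symm⟩
  · intro k _
    rw [siteOp, Matrix.of_apply, if_pos (by simp), tensorCovector,
      ← Finset.mul_prod_erase _ _ (Finset.mem_univ a), Function.update_self]
    have : ∏ b ∈ Finset.univ.erase a, s b (Function.update t a k b) =
        ∏ b ∈ Finset.univ.erase a, s b (t b) :=
      Finset.prod_congr rfl fun b hb => by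
        rw [Function.update_of_ne (Finset.ne_of_mem_erase hb)]
    rw [this]
    ring

lemma tensorCovector_vecMul_siteOp_pow {n N : ℕ} (s : Fin N → Fin n → ℂ) (a : Fin N)
    (A : Matrix (Fin n) (Fin n) ℂ) (k : ℕ) :
    Matrix.vecMul (tensorCovector s) (siteOp a A ^ k) =
      tensorCovector (Function.update s a (Matrix.vecMul (s a) (A ^ k))) := by
  induction k with
  | zero => simp
  | succ k ih =>
    rw [pow_succ, ← Matrix.vecMul_vecMul, ih, tensorCovector_vecMul_siteOp, Function.update_self,
      Function.update_idem, pow_succ, Matrix.vecMul_vecMul]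

lemma tensorCovector_vecMul_prod {n N : ℕ} (A : Fin N → Matrix (Fin n) (Fin n) ℂ) (h : Fin N → ℕ)
    (l : List (Fin N)) (hl : l.Nodup) (s : Fin N → Fin n → ℂ) :
    Matrix.vecMul (tensorCovector s) (l.map fun a => siteOp a (A a) ^ h a).prod =
      tensorCovector fun a => if a ∈ l then Matrix.vecMul (s a) (A a ^ h a) else s a := by
  induction l generalizing s with
  | nil => simp
  | cons b l ih =>
    rw [List.nodup_cons] at hl
    rw [List.map_cons, List.prod_cons, ← Matrix.vecMul_vecMul, tensorCovector_vecMul_siteOp_pow,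
      ih hl.2]
    congr 1
    funext a
    by_cases hab : a = b
    · subst hab
      simp [hl.1]
    · simp [hab]

/-- Tensor products of bases form a basis. -/
lemma isBasis_tensorCovector {n N : ℕ} (v : Fin N → Fin n → Fin n → ℂ) (hv : ∀ a, IsBasis (v a)) :
    IsBasis fun h : Fin N → Fin n => tensorCovector fun a => v a (h a) := by
  rw [isBasis_iff_det_ne_zero, ← isUnit_iff_ne_zero]
  have hu : ∀ a, Matrix.of (v a) * (Matrix.of (v a))⁻¹ = 1 := fun a =>
    Matrix.mul_nonsing_inv _ (isUnit_iff_ne_zero.2 ((isBasis_iff_det_ne_zero _).1 (hv a)))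
  refine Matrix.isUnit_det_of_right_inverse
    (B := Matrix.of fun (j i : Fin N → Fin n) => ∏ a, (Matrix.of (v a))⁻¹ (j a) (i a)) ?_
  ext h i
  rw [Matrix.mul_apply]
  simp only [Matrix.of_apply, tensorCovector, ← Finset.prod_mul_distrib]
  rw [← Fintype.piFinset_univ, ← Finset.prod_univ_sum (fun _ => Finset.univ)
    (fun a k => v a (h a) k * (Matrix.of (v a))⁻¹ k (i a))]
  have : ∀ a, ∑ k, v a (h a) k * (Matrix.of (v a))⁻¹ k (i a) =
      (1 : Matrix (Fin n) (Fin n) ℂ) (h a) (i a) := by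
    intro a
    rw [← hu a, Matrix.mul_apply]
    rfl
  simp only [this]
  by_cases hi : h = i
  · subst hi
    simp
  · obtain ⟨a, ha⟩ := Function.ne_iff.1 hi
    rw [Matrix.one_apply_ne hi]
    exact Finset.prod_eq_zero (Finset.mem_univ a) (Matrix.one_apply_ne ha)

lemma reducedDet_zero_ne_zero {n N : ℕ} (σ : ℂ) {ξ : Fin N → ℂ} {ζm ζp : ℂ}
    {Mm Mp : Matrix (Fin n) (Fin n) ℂ} {s : Fin N → Fin n → ℂ}
    (hsub : ∀ a b, b ≠ a → ξ a - ξ b ≠ 0) (hadd : ∀ a b, ξ a + ξ b ≠ 0)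
    (hs : ∀ a, IsCyclicCovector (s a) ((ζm • 1 + ξ a • Mm) * (ζp • 1 - ξ a • Mp))) :
    reducedDet σ 0 ξ ζm ζp Mm Mp (tensorCovector s) ≠ 0 := by
  set c : Fin N → ℂ := fun a => (∏ j, if j = a then 1 else ξ a - ξ j) * ∏ j, (ξ a + ξ j) with hc
  have hc0 : ∀ a, c a ≠ 0 := by
    intro a
    refine mul_ne_zero (Finset.prod_ne_zero_iff.2 fun j _ => ?_)
      (Finset.prod_ne_zero_iff.2 fun j _ => hadd a j)
    split_ifs with hj
    · exact one_ne_zero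
    · exact hsub a j hj
  rw [reducedDet, ← isBasis_iff_det_ne_zero]
  have h1 := (isBasis_smul_iff
    (fun h : Fin N → Fin n => ((List.finRange N).map fun a => c a ^ (h a : ℕ)).prod) (fun h => by
      rw [← List.ofFn_eq_map, List.prod_ofFn]
      exact Finset.prod_ne_zero_iff.2 fun a _ => pow_ne_zero _ (hc0 a)) _).2
    (isBasis_tensorCovector _ hs)
  convert h1 using 2 with h
  simp only [reducedTransfer_zero, smul_pow]
  rw [List.ofFn_eq_map, list_prod_map_smul, Matrix.vecMul_smul,
    tensorCovector_vecMul_prod (fun a => (ζm • 1 + ξ a • Mm) * (ζp • 1 - ξ a • Mp))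
      (fun a => (h a : ℕ)) _ (List.nodup_finRange N)]
  simp [hc]

/-! ### Polynomial dependence on the parameters -/

/-- The algebra of polynomial functions of the parameters indexed by `τ`. -/
def polyFun (τ : Type) : Subalgebra ℂ ((τ → ℂ) → ℂ) :=
  (AlgHom.pi fun x : τ → ℂ => MvPolynomial.aeval x).range

lemma mem_polyFun {τ : Type} {f : (τ → ℂ) → ℂ} :
    f ∈ polyFun τ ↔ ∃ P : MvPolynomial τ ℂ, ∀ x, MvPolynomial.eval x P = f x := by
  constructor
  · rintro ⟨P, rfl⟩
    exact ⟨P, fun x => rfl⟩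
  · rintro ⟨P, hP⟩
    exact ⟨P, funext hP⟩

lemma polyFun_coord {τ : Type} (i : τ) : (fun x : τ → ℂ => x i) ∈ polyFun τ :=
  mem_polyFun.2 ⟨MvPolynomial.X i, fun _ => MvPolynomial.eval_X i⟩

lemma polyFun_const {τ : Type} (c : ℂ) : (fun _ : τ → ℂ => c) ∈ polyFun τ :=
  (polyFun τ).algebraMap_mem c

lemma polyFun_add {τ : Type} {f g : (τ → ℂ) → ℂ} (hf : f ∈ polyFun τ) (hg : g ∈ polyFun τ) :
    (fun x => f x + g x) ∈ polyFun τ := add_mem hf hg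

lemma polyFun_sub {τ : Type} {f g : (τ → ℂ) → ℂ} (hf : f ∈ polyFun τ) (hg : g ∈ polyFun τ) :
    (fun x => f x - g x) ∈ polyFun τ := sub_mem hf hg

lemma polyFun_mul {τ : Type} {f g : (τ → ℂ) → ℂ} (hf : f ∈ polyFun τ) (hg : g ∈ polyFun τ) :
    (fun x => f x * g x) ∈ polyFun τ := mul_mem hf hg

lemma polyFun_sum {τ ι : Type} (s : Finset ι) {f : ι → (τ → ℂ) → ℂ}
    (hf : ∀ i, f i ∈ polyFun τ) : (fun x => ∑ i ∈ s, f i x) ∈ polyFun τ := by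
  have : (fun x => ∑ i ∈ s, f i x) = ∑ i ∈ s, f i := by
    ext x
    simp
  rw [this]
  exact sum_mem fun i _ => hf i

/-- The entries of the matrix `F x` are polynomial functions of the parameters `x`. -/
def IsPolyMatrix {τ ι κ : Type} (F : (τ → ℂ) → Matrix ι κ ℂ) : Prop :=
  ∀ i j, (fun x => F x i j) ∈ polyFun τ

namespace IsPolyMatrix

variable {τ ι κ : Type} {F G : (τ → ℂ) → Matrix ι ι ℂ}

lemma const (A : Matrix ι κ ℂ) : IsPolyMatrix fun _ : τ → ℂ => A := fun i j =>
  polyFun_const (A i j)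

lemma add (hF : IsPolyMatrix F) (hG : IsPolyMatrix G) : IsPolyMatrix fun x => F x + G x :=
  fun i j => polyFun_add (hF i j) (hG i j)

lemma sub (hF : IsPolyMatrix F) (hG : IsPolyMatrix G) : IsPolyMatrix fun x => F x - G x :=
  fun i j => polyFun_sub (hF i j) (hG i j)

lemma smul {c : (τ → ℂ) → ℂ} (hc : c ∈ polyFun τ) (hF : IsPolyMatrix F) :
    IsPolyMatrix fun x => c x • F x :=
  fun i j => polyFun_mul hc (hF i j)

lemma mul [Fintype ι] (hF : IsPolyMatrix F) (hG : IsPolyMatrix G) :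
    IsPolyMatrix fun x => F x * G x := by
  intro i j
  simp only [Matrix.mul_apply]
  exact polyFun_sum _ fun k => polyFun_mul (hF i k) (hG k j)

lemma list_prod [Fintype ι] [DecidableEq ι] {α : Type} (l : List α)
    {F : α → (τ → ℂ) → Matrix ι ι ℂ} (hF : ∀ a, IsPolyMatrix (F a)) :
    IsPolyMatrix fun x => (l.map fun a => F a x).prod := by
  induction l with
  | nil => exact const 1
  | cons a l ih =>
    simp only [List.map_cons, List.prod_cons]
    exact (hF a).mul ih

lemma pow [Fintype ι] [DecidableEq ι] (hF : IsPolyMatrix F) (k : ℕ) :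
    IsPolyMatrix fun x => F x ^ k := by
  induction k with
  | zero =>
    simp only [pow_zero]
    exact const 1
  | succ k ih =>
    simp only [pow_succ]
    exact ih.mul hF

lemma exists_map_eval [Fintype ι] [DecidableEq ι] (hF : IsPolyMatrix F) :
    ∃ P : Matrix ι ι (MvPolynomial τ ℂ), ∀ x, F x = (MvPolynomial.eval x).mapMatrix P := by
  choose P hP using fun i j => mem_polyFun.1 (hF i j)
  refine ⟨Matrix.of P, fun x => ?_⟩
  ext i j
  exact (hP i j x).symm

lemma det [Fintype ι] [DecidableEq ι] (hF : IsPolyMatrix F) :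
    (fun x => (F x).det) ∈ polyFun τ := by
  obtain ⟨P, hP⟩ := hF.exists_map_eval
  exact mem_polyFun.2 ⟨P.det, fun x => by rw [hP, RingHom.map_det]⟩

lemma adjugate [Fintype ι] [DecidableEq ι] (hF : IsPolyMatrix F) :
    IsPolyMatrix fun x => (F x).adjugate := by
  obtain ⟨P, hP⟩ := hF.exists_map_eval
  intro i j
  refine mem_polyFun.2 ⟨P.adjugate i j, fun x => ?_⟩
  change _ = (F x).adjugate i j
  rw [hP, ← RingHom.map_adjugate]
  rfl

end IsPolyMatrix

lemma isPolyMatrix_onAux {τ : Type} {n : ℕ} (N : ℕ) {F : (τ → ℂ) → Matrix (Fin n) (Fin n) ℂ}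
    (hF : IsPolyMatrix F) : IsPolyMatrix fun x => onAux N (F x) := fun i j =>
  polyFun_mul (hF i.1 j.1) (polyFun_const _)

lemma isPolyMatrix_rOp {τ : Type} (n : ℕ) {N : ℕ} {η u : (τ → ℂ) → ℂ} (hη : η ∈ polyFun τ)
    (hu : u ∈ polyFun τ) (j : Fin N) : IsPolyMatrix fun x => rOp n N (η x) (u x) j :=
  ((IsPolyMatrix.const 1).smul hu).add ((IsPolyMatrix.const _).smul hη)

lemma isPolyMatrix_reducedTransfer {τ : Type} {n N : ℕ} (σ : ℂ) {η zm zp : (τ → ℂ) → ℂ}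
    {ξ : Fin N → (τ → ℂ) → ℂ} {Fm Fp : (τ → ℂ) → Matrix (Fin n) (Fin n) ℂ}
    (hη : η ∈ polyFun τ) (hm : zm ∈ polyFun τ) (hp : zp ∈ polyFun τ) (hξ : ∀ a, ξ a ∈ polyFun τ)
    (hFm : IsPolyMatrix Fm) (hFp : IsPolyMatrix Fp) (a : Fin N) :
    IsPolyMatrix fun x => reducedTransfer σ (η x) (fun a => ξ a x) (zm x) (zp x) (Fm x) (Fp x) a
      := by
  have hK : IsPolyMatrix fun x => onAux N (zp x • (1 : Matrix (Fin n) (Fin n) ℂ) -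
      (ξ a x - σ * n * η x / 2) • Fp x) := by
    refine isPolyMatrix_onAux N (((IsPolyMatrix.const 1).smul hp).sub (IsPolyMatrix.smul ?_ hFp))
    simp only [div_eq_mul_inv]
    exact polyFun_sub (hξ a) (polyFun_mul (polyFun_mul (polyFun_const _) hη) (polyFun_const _))
  have hR : IsPolyMatrix fun x => ((List.finRange N).reverse.map
      (reducedFactor n (η x) (fun a => ξ a x) a)).prod := by
    refine IsPolyMatrix.list_prod _ (F := fun j x => reducedFactor n (η x) (fun a => ξ a x) a j)
      fun j => ?_
    by_cases hj : j = a
    · simp only [reducedFactor, if_pos hj]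
      exact IsPolyMatrix.const _
    · simp only [reducedFactor, if_neg hj]
      exact isPolyMatrix_rOp n hη (polyFun_sub (hξ a) (hξ j)) j
  have hM : IsPolyMatrix fun x => monodromyHat n N (η x) (fun a => ξ a x) (ξ a x) := by
    simp only [monodromyHat, List.ofFn_eq_map]
    exact IsPolyMatrix.list_prod _ fun j => isPolyMatrix_rOp n hη (polyFun_add (hξ a) (hξ j)) j
  have hX := ((hK.mul hR).mul (isPolyMatrix_onAux N
    (((IsPolyMatrix.const 1).smul hm).add (hFm.smul (hξ a))))).mul hM
  exact fun s t => polyFun_sum Finset.univ fun i => hX (i, s) (i, t)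

lemma polyFun_reducedDet {τ : Type} {n N : ℕ} (σ : ℂ) {η zm zp : (τ → ℂ) → ℂ}
    {ξ : Fin N → (τ → ℂ) → ℂ} {Fm Fp : (τ → ℂ) → Matrix (Fin n) (Fin n) ℂ}
    {S : QIdx n N → (τ → ℂ) → ℂ}
    (hη : η ∈ polyFun τ) (hm : zm ∈ polyFun τ) (hp : zp ∈ polyFun τ) (hξ : ∀ a, ξ a ∈ polyFun τ)
    (hFm : IsPolyMatrix Fm) (hFp : IsPolyMatrix Fp) (hS : ∀ i, S i ∈ polyFun τ) :
    (fun x => reducedDet σ (η x) (fun a => ξ a x) (zm x) (zp x) (Fm x) (Fp x)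
      (fun i => S i x)) ∈ polyFun τ := by
  refine IsPolyMatrix.det fun h j => ?_
  have hT := IsPolyMatrix.list_prod (List.finRange N) fun a =>
    (isPolyMatrix_reducedTransfer σ hη hm hp hξ hFm hFp a).pow (h a : ℕ)
  simp only [Matrix.of_apply, Matrix.vecMul, dotProduct, List.ofFn_eq_map]
  exact polyFun_sum _ fun i => polyFun_mul (hS i) (hT i j)

/-- A property that holds wherever two polynomial functions do not vanish holds almost everywhere as
soon as neither of them vanishes identically. -/
lemma almostAny_of_polyFun {τ : Type} {Q : (τ → ℂ) → Prop} {f g : (τ → ℂ) → ℂ}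
    (hf : f ∈ polyFun τ) (hg : g ∈ polyFun τ) (hf0 : ∃ x, f x ≠ 0) (hg0 : ∃ x, g x ≠ 0)
    (h : ∀ x, f x ≠ 0 → g x ≠ 0 → Q x) : AlmostAny Q := by
  obtain ⟨P, hP⟩ := mem_polyFun.1 hf
  obtain ⟨R, hR⟩ := mem_polyFun.1 hg
  obtain ⟨x, hx⟩ := hf0
  obtain ⟨y, hy⟩ := hg0
  refine ⟨P * R, mul_ne_zero ?_ ?_, fun z hz => ?_⟩
  · rintro rfl
    exact hx (by rw [← hP, map_zero])
  · rintro rfl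
    exact hy (by rw [← hR, map_zero])
  · rw [map_mul, hP, hR] at hz
    exact h z (left_ne_zero_of_mul hz) (right_ne_zero_of_mul hz)

/-! ### The basis property for almost any parameters -/

/-- The point `η = 0`, `ξ_a = a`, `ζ_- = α_-`, `ζ_+ = -α_+`, at which `ζ_- ζ_+ η⁻¹ T(ξ_a)` is a
nonzero multiple of `K_a^{(+,-)}` on site `a`. -/
def limitPoint (N : ℕ) (αm αp : ℂ) : ModelParam N → ℂ
  | .eta => 0
  | .xi a => (a : ℕ) + 1
  | .zetaMinus => αm
  | .zetaPlus => -αp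

/-- At `limitPoint` the co-vectors form a basis; `d` and `e` rescale the boundary matrices. -/
lemma reducedDet_limitPoint_ne_zero {n N : ℕ} (σ : ℂ) {αm αp d e : ℂ} (hd : d ≠ 0) (he : e ≠ 0)
    {Mm Mp : Matrix (Fin n) (Fin n) ℂ} {s : Fin N → Fin n → ℂ}
    (hs : ∀ a : Fin N, IsCyclicCovector (s a) (kProd αm αp Mm Mp ((a : ℕ) + 1))) :
    reducedDet σ 0 (fun a : Fin N => ((a : ℕ) : ℂ) + 1) (d * αm) (e * -αp) (d • Mm) (e • Mp)
      (tensorCovector s) ≠ 0 := by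
  refine reducedDet_zero_ne_zero σ (fun a b hab h => hab ?_) (fun a b => ?_) fun a => ?_
  · have h' : ((a : ℕ) : ℂ) = (b : ℕ) := by linear_combination h
    exact (Fin.ext (by exact_mod_cast h')).symm
  · have : ((a : ℕ) + 1 + ((b : ℕ) + 1) : ℕ) ≠ 0 := by positivity
    exact_mod_cast this
  · have h := isCyclicCovector_smul (c := -(d * e)) (neg_ne_zero.2 (mul_ne_zero hd he)) (hs a)
    convert h using 1
    rw [kProd]
    simp only [mul_add, add_mul, mul_sub, Matrix.smul_mul, Matrix.mul_smul, one_mul, mul_one,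
      smul_smul]
    push_cast
    module

lemma sovForAlmostAnyModel_of_isCyclicCovector {n N : ℕ} (σ : ℂ) {αm αp : ℂ}
    {Mm Mp : Matrix (Fin n) (Fin n) ℂ} {s : Fin N → Fin n → ℂ}
    (hs : ∀ a : Fin N, IsCyclicCovector (s a) (kProd αm αp Mm Mp ((a : ℕ) + 1))) :
    SoVForAlmostAnyModel σ Mm Mp (tensorCovector s) := by
  refine almostAny_of_polyFun (polyFun_coord ModelParam.eta)
    (polyFun_reducedDet σ (polyFun_coord ModelParam.eta) (polyFun_coord ModelParam.zetaMinus)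
      (polyFun_coord ModelParam.zetaPlus) (fun a => polyFun_coord (ModelParam.xi a))
      (IsPolyMatrix.const Mm) (IsPolyMatrix.const Mp) fun i => polyFun_const (tensorCovector s i))
    ⟨fun _ => 1, one_ne_zero⟩ ⟨limitPoint N αm αp, ?_⟩ ?_
  · have h := reducedDet_limitPoint_ne_zero σ one_ne_zero one_ne_zero hs
    simp only [one_mul, one_smul] at h
    exact h
  · intro x h1 h2 ⟨_, hm, hp⟩
    exact (isSoVBasis_iff σ _ h1 hm hp Mm Mp _).2 h2

/-- Since `W⁻¹ = (det W)⁻¹ adj W`, conjugated boundary matrices become polynomial in the entries of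
`W_±` once the factors `det W_±` are moved into `ζ_±`. -/
lemma sovForAlmostAny_of_hasSimpleSpectrum {n N : ℕ} (σ : ℂ) {Jm Jp : Matrix (Fin n) (Fin n) ℂ}
    {Wm Wp : Matrix (Fin n) (Fin n) ℂ} (hWm : IsUnit Wm) (hWp : IsUnit Wp) {αm αp : ℂ}
    (hspec : ∀ a : Fin N, HasSimpleSpectrum
      (kProd αm αp (Wm * Jm * Wm⁻¹) (Wp * Jp * Wp⁻¹) ((a : ℕ) + 1))) :
    SoVForAlmostAny n N σ Jm Jp := by
  choose s hs using fun a => exists_isCyclicCovector (hspec a)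
  have hdet : ∀ {W : Matrix (Fin n) (Fin n) ℂ}, IsUnit W → W.det ≠ 0 := fun h =>
    isUnit_iff_ne_zero.1 ((Matrix.isUnit_iff_isUnit_det _).1 h)
  have hadj : ∀ {W : Matrix (Fin n) (Fin n) ℂ} (J : Matrix (Fin n) (Fin n) ℂ), IsUnit W →
      W * J * W.adjugate = W.det • (W * J * W⁻¹) := by
    intro W J h
    rw [Matrix.inv_def, Matrix.mul_smul, smul_smul,
      Ring.mul_inverse_cancel _ ((Matrix.isUnit_iff_isUnit_det _).1 h), one_smul]
  have hFm : IsPolyMatrix fun x : FullParam n N → ℂ => Matrix.of fun i j => x (.wMinus i j) :=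
    fun i j => polyFun_coord _
  have hFp : IsPolyMatrix fun x : FullParam n N → ℂ => Matrix.of fun i j => x (.wPlus i j) :=
    fun i j => polyFun_coord _
  refine almostAny_of_polyFun (polyFun_coord (FullParam.model .eta))
    (polyFun_reducedDet σ (polyFun_coord (FullParam.model .eta))
      (polyFun_mul hFm.det (polyFun_coord (FullParam.model .zetaMinus)))
      (polyFun_mul hFp.det (polyFun_coord (FullParam.model .zetaPlus)))
      (fun a => polyFun_coord (FullParam.model (.xi a)))
      ((hFm.mul (IsPolyMatrix.const Jm)).mul hFm.adjugate)
      ((hFp.mul (IsPolyMatrix.const Jp)).mul hFp.adjugate)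
      fun i => polyFun_coord (FullParam.covec i))
    ⟨fun _ => 1, one_ne_zero⟩ ⟨fun
      | .model p => limitPoint N αm αp p
      | .covec i => tensorCovector s i
      | .wMinus i j => Wm i j
      | .wPlus i j => Wp i j, ?_⟩ ?_
  · have h := reducedDet_limitPoint_ne_zero σ (hdet hWm) (hdet hWp) hs
    rw [← hadj Jm hWm, ← hadj Jp hWp] at h
    exact h
  · intro x h1 h2 ⟨_, hm, hp⟩ Um Up hUm hUp hm1 hp1
    rw [← hUm, ← hUp, hadj Jm hm1, hadj Jp hp1] at h2
    rw [← isSoVBasis_smul_iff σ _ _ _ _ (hdet hm1) (hdet hp1), isSoVBasis_iff σ _ h1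
      (mul_ne_zero (hdet hm1) hm) (mul_ne_zero (hdet hp1) hp)]
    exact h2

end ReflectionSoV

end

theorem theorem5p1 (n N : ℕ) (hn : 1 ≤ n) (σ : ℂ) (hσ : σ = 1 ∨ σ = -1) :
    -- the generic conjugacy classes of boundary matrices, in all cases `r^(±) = 0, 1`
    (∀ Jm Jp : Matrix (Fin n) (Fin n) ℂ,
      ReflectionSoV.IsGenericForm Jm → ReflectionSoV.IsGenericForm Jp →
      ReflectionSoV.SoVForAlmostAny n N σ Jm Jp) ∧
    -- any other pair of conjugacy classes in which the simple spectrum condition occurs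
    (∀ Jm Jp : Matrix (Fin n) (Fin n) ℂ,
      ReflectionSoV.IsBoundary Jm → ReflectionSoV.IsBoundary Jp →
      (∃ Wm Wp : Matrix (Fin n) (Fin n) ℂ, IsUnit Wm ∧ IsUnit Wp ∧
        ∃ αm αp : ℂ, ∀ a : Fin N, ReflectionSoV.HasSimpleSpectrum
          (ReflectionSoV.kProd αm αp (Wm * Jm * Wm⁻¹) (Wp * Jp * Wp⁻¹) ((a : ℕ) + 1))) →
      ReflectionSoV.SoVForAlmostAny n N σ Jm Jp) ∧
    -- fixed boundary matrices and a tensor product co-vector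
    (∀ Mm Mp : Matrix (Fin n) (Fin n) ℂ,
      ReflectionSoV.IsBoundary Mm → ReflectionSoV.IsBoundary Mp →
      ∀ αm αp : ℂ,
      (∀ a : Fin N, ReflectionSoV.HasSimpleSpectrum
        (ReflectionSoV.kProd αm αp Mm Mp ((a : ℕ) + 1))) →
      (∃ s : Fin N → Fin n → ℂ, ∀ a : Fin N, ReflectionSoV.IsCyclicCovector (s a)
        (ReflectionSoV.kProd αm αp Mm Mp ((a : ℕ) + 1))) ∧
      ∀ s : Fin N → Fin n → ℂ,
        (∀ a : Fin N, ReflectionSoV.IsCyclicCovector (s a)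
          (ReflectionSoV.kProd αm αp Mm Mp ((a : ℕ) + 1))) →
        ReflectionSoV.SoVForAlmostAnyModel σ Mm Mp (ReflectionSoV.tensorCovector s)) := by
  refine ⟨fun Jm Jp hm hp => ?_, fun Jm Jp _ _ h => ?_,
    fun Mm Mp _ _ αm αp h => ⟨?_, fun s hs => ?_⟩⟩
  · obtain ⟨Wm, Wp, hWm, hWp, h⟩ :=
      ReflectionSoV.exists_hasSimpleSpectrum_of_isGenericForm hn hm hp
    exact ReflectionSoV.sovForAlmostAny_of_hasSimpleSpectrum σ hWm hWp fun a =>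
      h _ (Nat.succ_ne_zero a)
  · obtain ⟨Wm, Wp, hWm, hWp, αm, αp, h⟩ := h
    exact ReflectionSoV.sovForAlmostAny_of_hasSimpleSpectrum σ hWm hWp h
  · choose s hs using fun a => ReflectionSoV.exists_isCyclicCovector (h a)
    exact ⟨s, hs⟩
  · exact ReflectionSoV.sovForAlmostAnyModel_of_isCyclicCovector σ hs
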